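/- Let $n\ge 1$ and let $M$ be an $n$-dimensional affine manifold (a manifold with an atlas whose coordinate changes are locally affine maps of $\mathbb R^n$; equivalently, with a flat torsion-free connection $\nabla$) which is diffeomorphic to the torus $T^n$ and geodesically complete. On $\mathrm{aff}(\mathbb R^n)=\mathfrak{gl}(n,\mathbb R)\times\mathbb R^n$ consider the associative product $(C,c)(D,d)=(CD,\,C(d))$ and the exponential map $\exp$ to the affine group of $\mathbb R^n$. Suppose that the affine structure of $M$ is defined by a rational commutative associative algebra, in the following sense: there is a universal covering $p:\mathbb R^n\to M$ which is affine, the fundamental group $\pi_1(M)$, regarded as the group of affine transformations $g$ of $\mathbb R^n$ with $p\circ g=p$, has generators $\gamma_1,\dots,\gamma_n$ with $\gamma_i=\exp(C_i,c_i)$, where the elements $(C_1,c_1),\dots,(C_n,c_n)$ of $\mathrm{aff}(\mathbb R^n)$ commute pairwise, and the $\mathbb Q$-vector space generated by $(C_1,c_1),\dots,(C_n,c_n)$ is stable under the product. Then $M$ admits a parallel action of the circle $T^1$: there is a smooth effective action of $T^1$ on $M$ whose infinitesimal generator is a parallel vector field, that is, a vector field which is locally constant in the affine coordinates of $M$. 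-/

import Mathlib

open scoped Manifold ContDiff Topology

noncomputable section

/-- The model space `ℝⁿ`. -/
abbrev AffModel (n : ℕ) : Type := EuclideanSpace ℝ (Fin n)

/-- `f` agrees near every point of `s` with an affine map. -/
def IsLocallyAffineOn (n : ℕ) (f : AffModel n → AffModel n) (s : Set (AffModel n)) : Prop :=
  ∀ x ∈ s, ∃ u : Set (AffModel n), IsOpen u ∧ x ∈ u ∧
    ∃ A : AffModel n →ᵃ[ℝ] AffModel n, ∀ y ∈ s ∩ u, f y = A y

/-- The local homeomorphisms of `ℝⁿ` which, like their inverses, are locally affine, as a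
pregroupoid. -/
def affinePregroupoid (n : ℕ) : Pregroupoid (AffModel n) where
  property := IsLocallyAffineOn n
  comp := by
    intro f g u v hf hg _ _ _ x hx
    obtain ⟨a, ha, hxa, A, hA⟩ := hf x hx.1
    obtain ⟨b, hb, hxb, B, hB⟩ := hg (f x) hx.2
    refine ⟨a ∩ A ⁻¹' b, ha.inter (hb.preimage A.continuous_of_finiteDimensional),
      ⟨hxa, ?_⟩, B.comp A, ?_⟩
    · change A x ∈ b
      rw [← hA x ⟨hx.1, hxa⟩]
      exact hxb
    · rintro y ⟨⟨hyu, hyv⟩, hya, hyb⟩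
      have h1 : f y = A y := hA y ⟨hyu, hya⟩
      have h2 : f y ∈ b := by rw [h1]; exact hyb
      change g (f y) = B (A y)
      rw [← h1]
      exact hB (f y) ⟨hyv, h2⟩
  id_mem := fun x _ => ⟨Set.univ, isOpen_univ, trivial, AffineMap.id ℝ _, fun _ _ => rfl⟩
  locality := by
    intro f u _ h x hx
    obtain ⟨v, hv, hxv, hf⟩ := h x hx
    obtain ⟨w, hw, hxw, A, hA⟩ := hf x ⟨hx, hxv⟩
    exact ⟨v ∩ w, hv.inter hw, ⟨hxv, hxw⟩, A,
      fun y hy => hA y ⟨⟨hy.1, hy.2.1⟩, hy.2.2⟩⟩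
  congr := by
    intro f g u _ hfg hf x hx
    obtain ⟨v, hv, hxv, A, hA⟩ := hf x hx
    exact ⟨v, hv, hxv, A, fun y hy => by rw [hfg y hy.1]; exact hA y hy⟩

/-- The groupoid of locally affine transformations of `ℝⁿ`. An `n`-dimensional affine manifold is a
space `M` with `[ChartedSpace (AffModel n) M] [HasGroupoid M (affineGroupoid n)]`: an atlas whose
coordinate changes are locally affine. -/
def affineGroupoid (n : ℕ) : StructureGroupoid (AffModel n) :=
  (affinePregroupoid n).groupoid

/-- The `n`-dimensional torus `T¹ × ⋯ × T¹`, with its product smooth structure modelled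
on `torusModel n`. -/
abbrev Torus (n : ℕ) : Type := Fin n → Circle

/-- The model with corners (without boundary) of the product manifold `Torus n`. -/
abbrev torusModel (n : ℕ) :
    ModelWithCorners ℝ (Fin n → EuclideanSpace ℝ (Fin 1))
      (ModelPi fun _ : Fin n => EuclideanSpace ℝ (Fin 1)) :=
  ModelWithCorners.pi fun _ : Fin n => 𝓡 1

section AffineManifold

variable (n : ℕ) {M : Type*} [TopologicalSpace M] [ChartedSpace (AffModel n) M]

/-- A geodesic, defined for all times, of the flat torsion-free connection of an affine manifold:
in affine coordinates it is `t ↦ a + t v`. -/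
def IsAffineGeodesic (c : ℝ → M) : Prop :=
  Continuous c ∧ ∀ t₀ : ℝ, ∃ v : AffModel n, ∀ᶠ t in 𝓝 t₀,
    chartAt (AffModel n) (c t₀) (c t) =
      chartAt (AffModel n) (c t₀) (c t₀) + (t - t₀) • v

variable (M) in
/-- Geodesic completeness: for every point `x` and every initial velocity `v` (read in the preferred
chart at `x`) there is a geodesic with these initial data which is defined on all of `ℝ`. -/
def IsGeodesicallyComplete : Prop :=
  ∀ (x : M) (v : AffModel n), ∃ c : ℝ → M, IsAffineGeodesic n c ∧ c 0 = x ∧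
    ∀ᶠ t in 𝓝 (0 : ℝ),
      chartAt (AffModel n) x (c t) = chartAt (AffModel n) x x + t • v

/-- `p : ℝⁿ → M` is a universal covering which is affine for the affine structure of `M`. -/
structure IsAffineUniversalCover (p : AffModel n → M) : Prop where
  isCoveringMap : IsCoveringMap p
  surjective : Function.Surjective p
  locally_affine : ∀ x : AffModel n, ∃ A : AffModel n →ᵃ[ℝ] AffModel n, ∀ᶠ y in 𝓝 x,
    chartAt (AffModel n) (p x) (p y) = A y

/-- The group of affine deck transformations of `p : ℝⁿ → M`: the fundamental group of `M`, seen as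
a group of affine transformations of `ℝⁿ`, when `p` is an affine universal covering. -/
def deckGroup (p : AffModel n → M) : Subgroup (AffModel n ≃ᵃ[ℝ] AffModel n) where
  carrier := {g | ∀ x, p (g x) = p x}
  one_mem' := fun _ => rfl
  mul_mem' := by
    intro g h hg hh x
    exact (hg (h x)).trans (hh x)
  inv_mem' := by
    intro g hg x
    have h1 := hg (g⁻¹ x)
    have h2 : g (g⁻¹ x) = x := g.apply_symm_apply x
    rw [h2] at h1
    exact h1.symm

end AffineManifold

/-- The vector space `aff(ℝⁿ)` of pairs `(C, c)`, where `C` is an endomorphism of `ℝⁿ` and `c`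
belongs to `ℝⁿ`. -/
abbrev AffAlg (n : ℕ) : Type := (AffModel n →L[ℝ] AffModel n) × AffModel n

/-- The associative product `(C, c) (D, d) = (C D, C d)` of `aff(ℝⁿ)`. -/
def affMul {n : ℕ} (a b : AffAlg n) : AffAlg n := (a.1 * b.1, a.1 b.2)

/-- `(C, c)` as the endomorphism `(x, s) ↦ (C x + s c, 0)` of `ℝⁿ × ℝ`, that is, as the block matrix
with rows `C, c` and `0, 0`. -/
def affEnd {n : ℕ} (a : AffAlg n) : (AffModel n × ℝ) →L[ℝ] (AffModel n × ℝ) :=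
  (a.1.comp (ContinuousLinearMap.fst ℝ (AffModel n) ℝ) +
    (ContinuousLinearMap.snd ℝ (AffModel n) ℝ).smulRight a.2).prod 0

/-- The exponential map from `aff(ℝⁿ)` to the affine transformations of `ℝⁿ`, where `ℝⁿ` is the
affine hyperplane `ℝⁿ × {1}` of `ℝⁿ × ℝ`. -/
def affExp {n : ℕ} (a : AffAlg n) (x : AffModel n) : AffModel n :=
  (NormedSpace.exp (affEnd a) (x, (1 : ℝ))).1

/-- The affine structure of `M` is defined by a rational algebra. Here `M` is the quotient of `ℝⁿ`
by its group of deck transformations, which is generated by `γ₁, …, γₙ` with `γᵢ = exp (Cᵢ, cᵢ)`;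
the `(Cᵢ, cᵢ)` lie in one commutative algebra (their real span is the algebra `𝓗` that defines the
affine structure), and rationality means that their `ℚ`-linear span is stable under the product. -/
def HasRationalAlgebra (n : ℕ) (M : Type*) [TopologicalSpace M] [ChartedSpace (AffModel n) M] :
    Prop :=
  ∃ p : AffModel n → M, IsAffineUniversalCover n p ∧
    ∃ (γ : Fin n → (AffModel n ≃ᵃ[ℝ] AffModel n)) (a : Fin n → AffAlg n),
      Subgroup.closure (Set.range γ) = deckGroup n p ∧
      (∀ i x, γ i x = affExp (a i) x) ∧
      (∀ i j, affMul (a i) (a j) = affMul (a j) (a i)) ∧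
      ∀ b ∈ Submodule.span ℚ (Set.range a), ∀ c ∈ Submodule.span ℚ (Set.range a),
        affMul b c ∈ Submodule.span ℚ (Set.range a)

/-- The action `ρ` of the circle on the affine manifold `M` is smooth and parallel: the vector field
`y ↦ d/dt (exp (i t) y)` at `t = 0` that generates it is parallel, that is, locally constant in
affine coordinates. -/
structure IsParallelCircleAction (n : ℕ) {M : Type*} [TopologicalSpace M]
    [ChartedSpace (AffModel n) M] (ρ : Circle →* Equiv.Perm M) : Prop where
  smooth : ContMDiff ((𝓡 1).prod 𝓘(ℝ, AffModel n)) 𝓘(ℝ, AffModel n) ∞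
    (fun q : Circle × M => ρ q.1 q.2)
  parallel : ∀ x : M, ∃ u : AffModel n, ∀ᶠ y in 𝓝 x,
    HasDerivAt (fun t : ℝ => chartAt (AffModel n) x (ρ (Circle.exp t) y)) u 0

end

/-! Let `𝓗` be the rational span of the logarithms `a i`, a finite-dimensional commutative
`ℚ`-algebra. A positive multiple of any element of `𝓗` is an integral combination of the `a i`, and
so exponentiates to a deck transformation.

`𝓗` is nilpotent. If `b` is idempotent, the deck transformation `exp (m b)` fixes `-b.2`, hence is
the identity; but it scales the image of `b.1` by `e ^ m ≠ 1`, so `b = 0`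
(`eq_zero_of_affMul_self`). A finite-dimensional commutative algebra without nonzero idempotents is
nil.

The translation parts of `𝓗` span `ℝⁿ`. Otherwise, by nilpotency, some nonzero functional kills all
of them and also the images of all `(a i).1`. It is invariant under the deck group and descends to a
continuous function on the compact `M`; a nonzero linear functional is unbounded, a contradiction
(`eq_zero_of_forall_mem_span`).

Nilpotency also gives `z ≠ 0` in `𝓗` annihilated by every `a i`. By commutativity `z.1` kills all
translation parts, so `z.1 = 0`: a multiple of `z` is a deck translation, and its direction is fixed
by the linear parts of the deck group (`exists_translation`). The flow in this direction descends to
`M`; its periods form a discrete group, and parametrizing by a generator makes the circle action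
effective. -/

noncomputable section

/-! ### Nil commutative algebras and rational spans -/

section Algebra

/-- In a finite-dimensional commutative `ℚ`-algebra (inside a ring) without nonzero idempotents,
every element is nilpotent. -/
theorem isNilpotent_of_forall_idempotent_eq_zero {R : Type*} [Ring R] [Module ℚ R]
    (T : Submodule ℚ R) [Module.Finite ℚ T] (hmul : ∀ a ∈ T, ∀ b ∈ T, a * b ∈ T)
    (hcomm : ∀ a ∈ T, ∀ b ∈ T, a * b = b * a) (hidem : ∀ e ∈ T, e * e = e → e = 0)
    {a : R} (ha : a ∈ T) : IsNilpotent a := by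
  let f : T →ₗ[ℚ] T := (AddMonoidHom.mk' (fun t : T => (⟨a * t, hmul a ha t t.2⟩ : T))
    (fun s t => Subtype.ext (mul_add a s t))).toRatLinearMap
  have hf : ∀ (k : ℕ) (t : T), (((f ^ k) t : T) : R) = a ^ k * t := by
    intro k
    induction k with
    | zero => intro t; simp
    | succ k ih =>
      intro t
      rw [pow_succ', Module.End.mul_apply]
      change a * (((f ^ k) t : T) : R) = _
      rw [ih, pow_succ', mul_assoc]
  -- Exponents start at 1 because `T` need not contain the unit of `R`.
  have hpow : ∀ k : ℕ, a ^ (k + 1) ∈ T := by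
    intro k
    have h := hf k ⟨a, ha⟩
    rw [pow_succ, ← h]
    exact Subtype.property _
  obtain ⟨N, hN⟩ := IsArtinian.monotone_stabilizes f.iterateRange
  -- Fitting argument: the images of `f` stabilize, so `c = a ^ (N + 1)` satisfies `c = c * c * t`
  -- with `t` in `T`. Then `c * t` is idempotent, hence zero, and so is `c`.
  have hmem : (f ^ N) ⟨a, ha⟩ ∈ LinearMap.range (f ^ (2 * N + 2)) := by
    have h : LinearMap.range (f ^ N) = LinearMap.range (f ^ (2 * N + 2)) :=
      hN (2 * N + 2) (by omega)
    rw [← h]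
    exact ⟨_, rfl⟩
  obtain ⟨t, ht⟩ := hmem
  have hbt : a ^ (N + 1) * a ^ (N + 1) * t = a ^ (N + 1) := by
    have h := congrArg (Subtype.val) ht
    rw [hf, hf] at h
    rw [← pow_add, show N + 1 + (N + 1) = 2 * N + 2 by ring, h, pow_succ]
  have hcb := hcomm _ (hpow N) _ t.2
  have he : a ^ (N + 1) * (t : R) = 0 := by
    refine hidem _ (hmul _ (hpow N) _ t.2) ?_
    calc a ^ (N + 1) * (t : R) * (a ^ (N + 1) * t)
        = a ^ (N + 1) * ((t : R) * a ^ (N + 1)) * t := by simp only [mul_assoc]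
      _ = a ^ (N + 1) * a ^ (N + 1) * t * t := by rw [← hcb]; simp only [mul_assoc]
      _ = a ^ (N + 1) * t := by rw [hbt]
  exact ⟨N + 1, by rw [← hbt, mul_assoc, he, mul_zero]⟩

/-- Commuting nilpotent endomorphisms which preserve a set `P` containing a nonzero vector have
a common nonzero kernel vector in `P`. -/
theorem exists_ne_zero_forall_apply_eq_zero {ι R X : Type*} [Semiring R] [AddCommMonoid X]
    [Module R X] (f : ι → Module.End R X) (hcomm : ∀ i j, Commute (f i) (f j))
    (hnil : ∀ i, IsNilpotent (f i)) (P : Set X) (hP : ∀ i, ∀ x ∈ P, f i x ∈ P)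
    (h0 : ∃ x ∈ P, x ≠ 0) (s : Finset ι) : ∃ x ∈ P, x ≠ 0 ∧ ∀ i ∈ s, f i x = 0 := by
  classical
  induction s using Finset.induction_on with
  | empty =>
    obtain ⟨x, hx, hx0⟩ := h0
    exact ⟨x, hx, hx0, by simp⟩
  | insert i s _ ih =>
    obtain ⟨x, hx, hx0, hs⟩ := ih
    obtain ⟨k, hk⟩ := hnil i
    have hex : ∃ m : ℕ, (f i ^ m) x = 0 := ⟨k, by rw [hk]; rfl⟩
    -- The last nonzero iterate of `f i` on `x` is killed by `f i`, and by commutation still by the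
    -- earlier maps.
    obtain ⟨m, hm⟩ : ∃ m, Nat.find hex = m + 1 := by
      refine Nat.exists_eq_succ_of_ne_zero fun h => hx0 ?_
      simpa [h] using Nat.find_spec hex
    refine ⟨(f i ^ m) x, ?_, Nat.find_min hex (by omega), ?_⟩
    · clear hm
      induction m with
      | zero => simpa using hx
      | succ m ihm =>
        rw [pow_succ', Module.End.mul_apply]
        exact hP i _ ihm
    · intro j hj
      rcases Finset.mem_insert.1 hj with rfl | hj
      · rw [← Module.End.mul_apply, ← pow_succ', ← hm]
        exact Nat.find_spec hex
      · rw [← Module.End.mul_apply, ((hcomm j i).pow_right m).eq, Module.End.mul_apply, hs j hj,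
          map_zero]

/-- Meant for `P` the image of the rational algebra, where it yields an annihilator element. As `P`
is a mere set, `ℤ`-linear multiplications suffice. -/
theorem exists_ne_zero_forall_mul_eq_zero {ι R : Type*} [Ring R] (x : ι → R)
    (hcomm : ∀ i j, Commute (x i) (x j)) (hnil : ∀ i, IsNilpotent (x i)) (P : Set R)
    (hP : ∀ i, ∀ y ∈ P, x i * y ∈ P) (h0 : ∃ y ∈ P, y ≠ 0) (s : Finset ι) :
    ∃ y ∈ P, y ≠ 0 ∧ ∀ i ∈ s, x i * y = 0 := by
  refine exists_ne_zero_forall_apply_eq_zero (fun i => LinearMap.mulLeft ℤ (x i)) (fun i j => ?_)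
    (fun i => ?_) P hP h0 s
  · rw [Commute, SemiconjBy, Module.End.mul_eq_comp, Module.End.mul_eq_comp,
      ← LinearMap.mulLeft_mul, ← LinearMap.mulLeft_mul, (hcomm i j).eq]
  · obtain ⟨N, hN⟩ := hnil i
    exact ⟨N, by rw [LinearMap.pow_mulLeft, hN, LinearMap.mulLeft_zero_eq_zero]⟩

/-- A rational combination has a positive multiple which is an integral combination. -/
theorem exists_nsmul_mem_closure_of_mem_span_rat {X : Type*} [AddCommGroup X] [Module ℚ X]
    {s : Set X} {x : X} (hx : x ∈ Submodule.span ℚ s) :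
    ∃ m : ℕ, 0 < m ∧ m • x ∈ AddSubgroup.closure s := by
  induction hx using Submodule.span_induction with
  | mem x hx => exact ⟨1, one_pos, by simpa using AddSubgroup.subset_closure hx⟩
  | zero => exact ⟨1, one_pos, by simp⟩
  | add x y _ _ hx hy =>
    obtain ⟨k, hk, hkx⟩ := hx
    obtain ⟨l, hl, hly⟩ := hy
    refine ⟨k * l, Nat.mul_pos hk hl, ?_⟩
    rw [smul_add]
    refine add_mem ?_ ?_
    · rw [mul_comm, mul_smul]
      exact nsmul_mem hkx l
    · rw [mul_smul]
      exact nsmul_mem hly k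
  | smul q x _ hx =>
    obtain ⟨k, hk, hkx⟩ := hx
    refine ⟨q.den * k, Nat.mul_pos q.den_pos hk, ?_⟩
    have h : (q.den * k) • q • x = q.num • k • x := by
      rw [← Nat.cast_smul_eq_nsmul ℚ, ← Nat.cast_smul_eq_nsmul ℚ k, ← Int.cast_smul_eq_zsmul ℚ,
        smul_smul, smul_smul]
      congr 1
      push_cast
      rw [mul_right_comm, Rat.den_mul_eq_num]
    rw [h]
    exact zsmul_mem hkx _

theorem commute_of_mem_span_rat {R : Type*} [Ring R] [Module ℚ R] {s : Set R}
    (hs : ∀ a ∈ s, ∀ b ∈ s, Commute a b) {a b : R} (ha : a ∈ Submodule.span ℚ s)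
    (hb : b ∈ Submodule.span ℚ s) : Commute a b := by
  have key : ∀ a b : R, (∀ c ∈ s, Commute a c) → b ∈ Submodule.span ℚ s → Commute a b := by
    intro a b h hb
    induction hb using Submodule.span_induction with
    | mem x hx => exact h x hx
    | zero => exact Commute.zero_right a
    | add x y _ _ hx hy => exact hx.add_right hy
    | smul q x _ hx =>
      -- Additive maps between `ℚ`-vector spaces are `ℚ`-linear, so no algebra structure is needed.
      have h1 := ((AddMonoidHom.mulLeft a).toRatLinearMap).map_smul q x
      have h2 := ((AddMonoidHom.mulRight a).toRatLinearMap).map_smul q x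
      simp only [AddMonoidHom.coe_toRatLinearMap, AddMonoidHom.coe_mulLeft,
        AddMonoidHom.coe_mulRight] at h1 h2
      change a * (q • x) = (q • x) * a
      rw [h1, h2, hx.eq]
  exact key a b (fun c hc => (key c a (fun d hd => hs c hc d hd) ha).symm) hb

end Algebra

/-! ### Exponentials of operators on special vectors -/

section Exponential

variable {V : Type*} [NormedAddCommGroup V] [NormedSpace ℝ V] [CompleteSpace V]

theorem hasSum_exp_apply (X : V →L[ℝ] V) (w : V) :
    HasSum (fun k : ℕ => ((k.factorial : ℝ)⁻¹) • (X ^ k) w) (NormedSpace.exp X w) := by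
  have h := (NormedSpace.exp_series_hasSum_exp' (𝕂 := ℝ) X).mapL
    (ContinuousLinearMap.apply ℝ V w)
  simpa using h

theorem exp_add_apply_of_commute {X Y : V →L[ℝ] V} (h : Commute X Y) (w : V) :
    NormedSpace.exp (X + Y) w = NormedSpace.exp X (NormedSpace.exp Y w) := by
  let _ : NormedAlgebra ℚ (V →L[ℝ] V) := NormedAlgebra.restrictScalars ℚ ℝ (V →L[ℝ] V)
  rw [NormedSpace.exp_add_of_commute h, mul_apply_eq_comp]

theorem exp_apply_of_apply_eq_smul {X : V →L[ℝ] V} {w : V} {r : ℝ} (h : X w = r • w) :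
    NormedSpace.exp X w = Real.exp r • w := by
  have hpow : ∀ k : ℕ, (X ^ k) w = r ^ k • w := by
    intro k
    induction k with
    | zero => simp
    | succ k ih =>
      rw [pow_succ', mul_apply_eq_comp, ih, map_smul, h, smul_smul, pow_succ]
  have h1 := hasSum_exp_apply X w
  have h2 := (NormedSpace.exp_series_hasSum_exp' (𝕂 := ℝ) r).smul_const w
  rw [← Real.exp_eq_exp_ℝ] at h2
  refine h1.unique ?_
  convert h2 using 2 with k
  rw [hpow, smul_smul, smul_eq_mul]

theorem exp_apply_of_apply_apply_eq_zero {X : V →L[ℝ] V} {w : V} (h : X (X w) = 0) :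
    NormedSpace.exp X w = w + X w := by
  have h1 := hasSum_exp_apply X w
  have h2 : HasSum (fun k : ℕ => ((k.factorial : ℝ)⁻¹) • (X ^ k) w)
      (∑ k ∈ Finset.range 2, ((k.factorial : ℝ)⁻¹) • (X ^ k) w) := by
    refine hasSum_sum_of_ne_finset_zero fun k hk => ?_
    obtain ⟨m, rfl⟩ : ∃ m, k = m + 2 := ⟨k - 2, by simp at hk; omega⟩
    rw [pow_add, pow_two, mul_apply_eq_comp, mul_apply_eq_comp, h,
      map_zero, smul_zero]
  rw [h1.unique h2]
  simp [Finset.sum_range_succ]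

/-- Only the constant term of the series survives `l`. This serves both to keep the last coordinate
equal to 1 and to find functionals invariant under the deck group. -/
theorem apply_exp_apply_of_forall_apply_eq_zero {X : V →L[ℝ] V} {l : V →L[ℝ] ℝ}
    (h : ∀ w, l (X w) = 0) (w : V) : l (NormedSpace.exp X w) = l w := by
  have h1 := (hasSum_exp_apply X w).mapL l
  have h2 : HasSum (fun k : ℕ => l (((k.factorial : ℝ)⁻¹) • (X ^ k) w)) (l w) := by
    have h3 := hasSum_single (f := fun k : ℕ => l (((k.factorial : ℝ)⁻¹) • (X ^ k) w)) 0 ?_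
    · simpa using h3
    · intro k hk
      obtain ⟨m, rfl⟩ := Nat.exists_eq_succ_of_ne_zero hk
      rw [map_smul, Nat.succ_eq_add_one, pow_succ', mul_apply_eq_comp, h, smul_zero]
  exact h1.unique h2

end Exponential

/-! ### Deck transformations of an affine covering -/

section Covering

theorem AffineMap.hasFDerivAt_of_finiteDimensional {V W : Type*} [NormedAddCommGroup V]
    [NormedSpace ℝ V] [FiniteDimensional ℝ V] [NormedAddCommGroup W] [NormedSpace ℝ W]
    (A : V →ᵃ[ℝ] W) (x : V) : HasFDerivAt A (LinearMap.toContinuousLinearMap A.linear) x := by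
  have h : (A : V → W) = fun y => LinearMap.toContinuousLinearMap A.linear y + A 0 := by
    ext y
    exact congrFun A.decomp y
  rw [h]
  exact (ContinuousLinearMap.hasFDerivAt _).add_const _

/-- A map which agrees with an affine map near every point is affine. -/
theorem exists_affineMap_of_forall_eventuallyEq {V W : Type*} [NormedAddCommGroup V]
    [NormedSpace ℝ V] [FiniteDimensional ℝ V] [NormedAddCommGroup W] [NormedSpace ℝ W]
    {g : V → W} (hg : ∀ x, ∃ A : V →ᵃ[ℝ] W, g =ᶠ[𝓝 x] A) : ∃ A : V →ᵃ[ℝ] W, g = A := by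
  choose A hA using hg
  have hd : ∀ x, HasFDerivAt g (LinearMap.toContinuousLinearMap (A x).linear) x := fun x =>
    ((A x).hasFDerivAt_of_finiteDimensional x).congr_of_eventuallyEq (hA x)
  -- By connectedness the derivative is constant, and subtracting it leaves a map with zero
  -- derivative.
  have hloc : IsLocallyConstant (fderiv ℝ g) := by
    refine (IsLocallyConstant.iff_eventually_eq _).2 fun x => ?_
    filter_upwards [(hA x).eventuallyEq_nhds] with y hy
    rw [(hd x).fderiv]
    exact (((A x).hasFDerivAt_of_finiteDimensional y).congr_of_eventuallyEq hy).fderiv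
  have hconst : ∀ x y, g x - fderiv ℝ g 0 x = g y - fderiv ℝ g 0 y := by
    refine is_const_of_fderiv_eq_zero (𝕜 := ℝ) (f := fun z => g z - fderiv ℝ g 0 z)
      (fun x => ((hd x).fun_sub (fderiv ℝ g 0).hasFDerivAt).differentiableAt) fun x => ?_
    rw [((hd x).fun_sub (fderiv ℝ g 0).hasFDerivAt).fderiv, ← (hd x).fderiv,
      hloc.apply_eq_of_preconnectedSpace x 0, sub_self]
  refine ⟨(fderiv ℝ g 0 : V →ₗ[ℝ] W).toAffineMap + AffineMap.const ℝ V (g 0), ?_⟩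
  ext x
  have h := hconst x 0
  simp only [map_zero, sub_zero] at h
  simp [← h]

variable {n : ℕ} {M : Type*} [TopologicalSpace M] [ChartedSpace (AffModel n) M]
  {p : AffModel n → M}

namespace IsAffineUniversalCover

/-- An affine universal covering is, in an affine chart, locally an affine isomorphism. -/
theorem exists_affineEquiv (hp : IsAffineUniversalCover n p) (x : AffModel n) :
    ∃ A : AffModel n ≃ᵃ[ℝ] AffModel n, ∀ᶠ y in 𝓝 x,
      chartAt (AffModel n) (p x) (p y) = A y := by
  obtain ⟨A, hA⟩ := hp.locally_affine x
  obtain ⟨e, hxe, he⟩ := hp.isCoveringMap.isLocalHomeomorph x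
  have hsrc : ∀ᶠ y in 𝓝 x, p y ∈ (chartAt (AffModel n) (p x)).source :=
    hp.isCoveringMap.continuous.continuousAt.eventually
      ((chartAt (AffModel n) (p x)).open_source.mem_nhds (mem_chart_source _ _))
  -- Along a kernel direction `p` would be constant near `x`, against local injectivity.
  have hinj : Function.Injective A.linear := by
    refine (injective_iff_map_eq_zero A.linear).2 fun k hk => ?_
    have htend : Filter.Tendsto (fun t : ℝ => x + t • k) (𝓝[≠] 0) (𝓝 x) := by
      have h : Filter.Tendsto (fun t : ℝ => x + t • k) (𝓝 0) (𝓝 (x + (0 : ℝ) • k)) :=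
        Continuous.tendsto (by fun_prop) 0
      rw [zero_smul, add_zero] at h
      exact h.mono_left nhdsWithin_le_nhds
    have hne : ∀ᶠ t : ℝ in 𝓝[≠] 0, t ≠ 0 := eventually_mem_nhdsWithin
    obtain ⟨t, ht1, ht2, ht3, ht0⟩ := ((htend.eventually hA).and ((htend.eventually hsrc).and
      ((htend.eventually (e.open_source.mem_nhds hxe)).and hne))).exists
    have hAx : A (x + t • k) = A x := by
      have h := A.map_vadd x (t • k)
      rw [map_smul, hk, smul_zero, zero_vadd, vadd_eq_add, add_comm] at h
      exact h
    have h1 : p (x + t • k) = p x := by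
      refine (chartAt (AffModel n) (p x)).injOn ht2 (mem_chart_source _ _) ?_
      rw [ht1, hAx, hA.self_of_nhds]
    rw [he] at h1
    have h2 := e.injOn ht3 hxe h1
    have h3 : t • k = 0 := by simpa using h2
    exact (smul_eq_zero.1 h3).resolve_left ht0
  have hbij : Function.Bijective A :=
    ⟨A.linear_injective_iff.1 hinj,
      A.linear_surjective_iff.1 (LinearMap.injective_iff_surjective.1 hinj)⟩
  exact ⟨AffineEquiv.ofBijective hbij, hA⟩

/-- Since `ℝⁿ` is simply connected, `p` lifts through itself with prescribed base points; uniqueness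
makes the two lifts inverse to each other, and in charts the lift is locally affine, hence affine.
-/
theorem exists_mem_deckGroup (hp : IsAffineUniversalCover n p) {x y : AffModel n}
    (hxy : p x = p y) : ∃ g ∈ deckGroup n p, g x = y := by
  have hlift : ∀ a b : AffModel n, p a = p b →
      ∃ F : C(AffModel n, AffModel n), F a = b ∧ p ∘ F = p := fun a b h =>
    (hp.isCoveringMap.existsUnique_continuousMap_lifts ⟨p, hp.isCoveringMap.continuous⟩ a b
      h.symm).exists
  obtain ⟨F, hF, hpF⟩ := hlift x y hxy
  obtain ⟨G, hG, hpG⟩ := hlift y x hxy.symm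
  have huniq : ∀ F G : C(AffModel n, AffModel n), p ∘ F = p → p ∘ G = p → ∀ a, G (F a) = a →
      ∀ z, G (F z) = z := by
    intro F G hF hG a ha z
    refine congrFun (hp.isCoveringMap.eq_of_comp_eq (g₁ := G ∘ F) (g₂ := id)
      (G.continuous.comp F.continuous) continuous_id ?_ a ha) z
    rw [← Function.comp_assoc, hG, hF, Function.comp_id]
  have hGF := huniq F G hpF hpG x (by rw [hF, hG])
  have hFG := huniq G F hpG hpF y (by rw [hG, hF])
  obtain ⟨A, hA⟩ : ∃ A : AffModel n →ᵃ[ℝ] AffModel n, (F : AffModel n → AffModel n) = A := by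
    refine exists_affineMap_of_forall_eventuallyEq fun w => ?_
    have hpw : p (F w) = p w := congrFun hpF w
    obtain ⟨B, hB⟩ := hp.exists_affineEquiv w
    obtain ⟨C, hC⟩ := hp.exists_affineEquiv (F w)
    refine ⟨(C.symm : AffModel n →ᵃ[ℝ] AffModel n).comp B, ?_⟩
    filter_upwards [hB, F.continuous.continuousAt.eventually hC] with z hz1 hz2
    have hpz : p (F z) = p z := congrFun hpF z
    rw [hpw, hpz, hz1] at hz2
    simp [hz2]
  have hbij : Function.Bijective A := by
    rw [← hA]
    exact ⟨Function.LeftInverse.injective hGF, Function.RightInverse.surjective hFG⟩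
  refine ⟨AffineEquiv.ofBijective hbij, fun z => ?_, ?_⟩
  · change p (A z) = p z
    rw [← hA]
    exact congrFun hpF z
  · change A x = y
    rw [← hA, hF]

/-- A deck transformation with a fixed point is the identity. -/
theorem apply_eq_self_of_mem_deckGroup (hp : IsAffineUniversalCover n p)
    {g : AffModel n ≃ᵃ[ℝ] AffModel n} (hg : g ∈ deckGroup n p) {x : AffModel n} (hx : g x = x)
    (y : AffModel n) : g y = y :=
  congrFun (hp.isCoveringMap.eq_of_comp_eq (g₁ := g) (g₂ := id)
    g.toAffineMap.continuous_of_finiteDimensional continuous_id (funext hg) x hx) y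

/-- On a compact affine manifold, a linear functional invariant under the deck group vanishes. -/
theorem eq_zero_of_forall_mem_deckGroup (hp : IsAffineUniversalCover n p) [CompactSpace M]
    (l : AffModel n →L[ℝ] ℝ) (hl : ∀ g ∈ deckGroup n p, ∀ x, l (g x) = l x) : l = 0 := by
  by_contra hne
  obtain ⟨v, hv⟩ : ∃ v, l v ≠ 0 := by
    by_contra! h
    exact hne (ContinuousLinearMap.ext h)
  have hquot : IsOpenQuotientMap p :=
    ⟨hp.surjective, hp.isCoveringMap.continuous, hp.isCoveringMap.isLocalHomeomorph.isOpenMap⟩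
  have hfac : ∀ x y, p x = p y → l x = l y := by
    intro x y hxy
    obtain ⟨g, hg, rfl⟩ := hp.exists_mem_deckGroup hxy
    exact (hl g hg x).symm
  let f : M → ℝ := fun m => l (Function.surjInv hp.surjective m)
  have hf : f ∘ p = l := funext fun x => hfac _ _ (Function.surjInv_eq hp.surjective (p x))
  have hfc : Continuous f := by
    rw [hquot.isQuotientMap.continuous_iff, hf]
    exact l.continuous
  obtain ⟨C, hC⟩ := (isCompact_range hfc).bddAbove
  -- The functional takes the value `C + 1` on a suitable multiple of `v`.
  have h : (C + 1) ≤ C := by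
    refine hC ⟨p (((C + 1) / l v) • v), ?_⟩
    have := congrFun hf (((C + 1) / l v) • v)
    simp only [Function.comp_apply] at this
    rw [this, map_smul, smul_eq_mul, div_mul_cancel₀ _ hv]
  linarith

end IsAffineUniversalCover

end Covering

/-! ### The affine algebra and its exponential -/

section AffineAlgebra

variable {n : ℕ}

theorem affEnd_apply (a : AffAlg n) (w : AffModel n × ℝ) :
    affEnd a w = (a.1 w.1 + w.2 • a.2, 0) := rfl

theorem affEnd_add (a b : AffAlg n) : affEnd (a + b) = affEnd a + affEnd b := by
  refine ContinuousLinearMap.ext fun w => ?_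
  simp only [add_apply, affEnd_apply, Prod.fst_add, Prod.snd_add,
    smul_add, Prod.mk_add_mk, add_zero]
  congr 1
  abel

theorem affEnd_affMul (a b : AffAlg n) : affEnd (affMul a b) = affEnd a * affEnd b := by
  refine ContinuousLinearMap.ext fun w => ?_
  simp [affEnd_apply, affMul, mul_apply_eq_comp]

theorem affEnd_injective : Function.Injective (affEnd (n := n)) := by
  intro a b h
  have h1 : ∀ w, affEnd a w = affEnd b w := fun w => by rw [h]
  refine Prod.ext (ContinuousLinearMap.ext fun x => ?_) ?_
  · simpa [affEnd_apply] using h1 (x, 0)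
  · simpa [affEnd_apply] using h1 (0, 1)

/-- `affEnd` as a `ℚ`-linear map. -/
def affEndRat (n : ℕ) : AffAlg n →ₗ[ℚ] ((AffModel n × ℝ) →L[ℝ] (AffModel n × ℝ)) :=
  (AddMonoidHom.mk' affEnd affEnd_add).toRatLinearMap

theorem exp_affEnd_apply (a : AffAlg n) (x : AffModel n) :
    NormedSpace.exp (affEnd a) (x, (1 : ℝ)) = (affExp a x, 1) := by
  refine Prod.ext rfl ?_
  exact apply_exp_apply_of_forall_apply_eq_zero (X := affEnd a)
    (l := ContinuousLinearMap.snd ℝ (AffModel n) ℝ) (fun _ => rfl) (x, 1)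

theorem affExp_add_of_apply_eq_zero {a : AffAlg n} {v : AffModel n} (hv : a.1 v = 0)
    (x : AffModel n) : affExp a (x + v) = affExp a x + v := by
  have h1 : affEnd a (v, 0) = (0 : ℝ) • (v, (0 : ℝ)) := by simp [affEnd_apply, hv]
  have h2 : NormedSpace.exp (affEnd a) (v, (0 : ℝ)) = (v, 0) := by
    rw [exp_apply_of_apply_eq_smul h1, Real.exp_zero, one_smul]
  have h3 : ((x + v, 1) : AffModel n × ℝ) = (x, 1) + (v, 0) := by simp
  rw [affExp, h3, map_add, h2, Prod.fst_add, affExp]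

theorem affExp_of_fst_eq_zero {a : AffAlg n} (ha : a.1 = 0) (x : AffModel n) :
    affExp a x = x + a.2 := by
  rw [affExp, exp_apply_of_apply_apply_eq_zero]
  · simp [affEnd_apply, ha]
  · simp [affEnd_apply, ha]

theorem apply_affExp_of_forall_apply_eq_zero {a : AffAlg n} {l : AffModel n →L[ℝ] ℝ}
    (h1 : ∀ x, l (a.1 x) = 0) (h2 : l a.2 = 0) (x : AffModel n) : l (affExp a x) = l x := by
  refine apply_exp_apply_of_forall_apply_eq_zero (X := affEnd a)
    (l := l.comp (ContinuousLinearMap.fst ℝ (AffModel n) ℝ)) (fun w => ?_) (x, 1)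
  simp [affEnd_apply, h1, h2]

section Span

variable {a : Fin n → AffAlg n} (hcomm : ∀ i j, affMul (a i) (a j) = affMul (a j) (a i))

include hcomm

theorem commute_affEnd_of_mem_span {b c : AffAlg n} (hb : b ∈ Submodule.span ℚ (Set.range a))
    (hc : c ∈ Submodule.span ℚ (Set.range a)) : Commute (affEnd b) (affEnd c) := by
  refine commute_of_mem_span_rat (s := affEndRat n '' Set.range a) ?_ ?_ ?_
  · rintro _ ⟨_, ⟨i, rfl⟩, rfl⟩ _ ⟨_, ⟨j, rfl⟩, rfl⟩
    change affEnd (a i) * affEnd (a j) = affEnd (a j) * affEnd (a i)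
    rw [← affEnd_affMul, hcomm, affEnd_affMul]
  · rw [← Submodule.map_span]
    exact ⟨b, hb, rfl⟩
  · rw [← Submodule.map_span]
    exact ⟨c, hc, rfl⟩

variable {G : Subgroup (AffModel n ≃ᵃ[ℝ] AffModel n)}

/-- Exponentials of integral combinations of commuting logarithms of elements of a group belong
to the group. -/
theorem exists_mem_eq_affExp (hG : ∀ i, ∃ g ∈ G, ∀ x, g x = affExp (a i) x) {b : AffAlg n}
    (hb : b ∈ AddSubgroup.closure (Set.range a)) : ∃ g ∈ G, ∀ x, g x = affExp b x := by
  have hle : AddSubgroup.closure (Set.range a) ≤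
      (Submodule.span ℚ (Set.range a)).toAddSubgroup :=
    (AddSubgroup.closure_le _).2 Submodule.subset_span
  induction hb using AddSubgroup.closure_induction with
  | mem b hb =>
    obtain ⟨i, rfl⟩ := hb
    exact hG i
  | zero =>
    refine ⟨1, one_mem _, fun x => ?_⟩
    rw [affExp_of_fst_eq_zero rfl]
    simp
  | add b c hb hc ihb ihc =>
    obtain ⟨g, hg, hgb⟩ := ihb
    obtain ⟨h, hh, hhc⟩ := ihc
    refine ⟨g * h, mul_mem hg hh, fun x => ?_⟩
    change g (h x) = _
    rw [hgb, hhc, affExp, ← exp_affEnd_apply,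
      ← exp_add_apply_of_commute (commute_affEnd_of_mem_span hcomm (hle hb) (hle hc)),
      ← affEnd_add, affExp]
  | neg b hb ihb =>
    obtain ⟨g, hg, hgb⟩ := ihb
    refine ⟨g⁻¹, inv_mem hg, fun x => ?_⟩
    have h : g (affExp (-b) x) = x := by
      have hneg : affEnd (-b) = -affEnd b := (affEndRat n).map_neg b
      rw [hgb, affExp, ← exp_affEnd_apply, hneg,
        ← exp_add_apply_of_commute (Commute.refl (affEnd b)).neg_right, add_neg_cancel,
        NormedSpace.exp_zero, one_apply_eq_self]
    rw [← h]
    exact (g.symm_apply_apply _).trans (by rw [h])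

end Span

end AffineAlgebra

/-! ### Nilpotency and the central deck translation -/

section Translation

variable {n : ℕ} {M : Type*} [TopologicalSpace M] [ChartedSpace (AffModel n) M]
  {p : AffModel n → M}

namespace IsAffineUniversalCover

/-- An idempotent of `aff(ℝⁿ)` one of whose positive multiples exponentiates to a deck
transformation vanishes. -/
theorem eq_zero_of_affMul_self (hp : IsAffineUniversalCover n p) {b : AffAlg n}
    (hb : affMul b b = b) {m : ℕ} (hm : 0 < m)
    (hexp : ∃ g ∈ deckGroup n p, ∀ x, g x = affExp (m • b) x) : b = 0 := by
  obtain ⟨g, hg, hgb⟩ := hexp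
  have hb1 : ∀ y, b.1 (b.1 y) = b.1 y := fun y => by
    have h := congrArg (fun c : AffAlg n => c.1 y) hb
    simpa [affMul, mul_apply_eq_comp] using h
  have hb2 : b.1 b.2 = b.2 := congrArg Prod.snd hb
  -- `b.1 b.2 = b.2` puts `(-b.2, 1)` in the kernel of `affEnd b`.
  have hfix : NormedSpace.exp (affEnd (m • b)) (-b.2, (1 : ℝ)) = (-b.2, 1) := by
    rw [exp_apply_of_apply_eq_smul (r := 0), Real.exp_zero, one_smul]
    simp [affEnd_apply, hb2]
  have hgid : ∀ y, g y = y := by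
    refine hp.apply_eq_self_of_mem_deckGroup hg (x := -b.2) ?_
    rw [hgb, affExp, hfix]
  have hzero : ∀ y, b.1 y = 0 := by
    intro y
    have h1 : NormedSpace.exp (affEnd (m • b)) (b.1 y, (0 : ℝ)) =
        Real.exp m • (b.1 y, (0 : ℝ)) := by
      refine exp_apply_of_apply_eq_smul ?_
      simp [affEnd_apply, hb1, ← Nat.cast_smul_eq_nsmul ℝ]
    have h2 := hgid (-b.2 + b.1 y)
    have h3 : ((-b.2 + b.1 y, 1) : AffModel n × ℝ) = (-b.2, 1) + (b.1 y, 0) := by simp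
    rw [hgb, affExp, h3, map_add, hfix, h1, Prod.fst_add, Prod.smul_fst, add_right_inj] at h2
    have h4 : (Real.exp m - 1) • b.1 y = 0 := by rw [sub_smul, one_smul, h2, sub_self]
    refine (smul_eq_zero.1 h4).resolve_left (sub_ne_zero.2 ?_)
    exact (Real.one_lt_exp_iff.2 (Nat.cast_pos.2 hm)).ne'
  refine Prod.ext (ContinuousLinearMap.ext hzero) ?_
  rw [← hb2]
  exact hzero _

variable {γ : Fin n → (AffModel n ≃ᵃ[ℝ] AffModel n)} {a : Fin n → AffAlg n}

theorem isNilpotent_affEnd (hp : IsAffineUniversalCover n p)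
    (hγ : Subgroup.closure (Set.range γ) = deckGroup n p)
    (hexp : ∀ i x, γ i x = affExp (a i) x)
    (hcomm : ∀ i j, affMul (a i) (a j) = affMul (a j) (a i))
    (hmul : ∀ b ∈ Submodule.span ℚ (Set.range a), ∀ c ∈ Submodule.span ℚ (Set.range a),
      affMul b c ∈ Submodule.span ℚ (Set.range a))
    {b : AffAlg n} (hb : b ∈ Submodule.span ℚ (Set.range a)) : IsNilpotent (affEnd b) := by
  have hfin : Module.Finite ℚ (Submodule.span ℚ (Set.range a)) :=
    Module.Finite.span_of_finite ℚ (Set.finite_range a)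
  refine isNilpotent_of_forall_idempotent_eq_zero
    ((Submodule.span ℚ (Set.range a)).map (affEndRat n)) ?_ ?_ ?_ ⟨b, hb, rfl⟩
  · rintro _ ⟨b, hb, rfl⟩ _ ⟨c, hc, rfl⟩
    exact ⟨affMul b c, hmul b hb c hc, affEnd_affMul b c⟩
  · rintro _ ⟨b, hb, rfl⟩ _ ⟨c, hc, rfl⟩
    exact commute_affEnd_of_mem_span hcomm hb hc
  · rintro _ ⟨b, hb, rfl⟩ he
    obtain ⟨m, hm, hmb⟩ := exists_nsmul_mem_closure_of_mem_span_rat hb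
    rw [hp.eq_zero_of_affMul_self (b := b) ?_ hm ?_, map_zero]
    · exact affEnd_injective ((affEnd_affMul b b).trans he)
    · refine exists_mem_eq_affExp hcomm (fun i => ⟨γ i, ?_, hexp i⟩) hmb
      rw [← hγ]
      exact Subgroup.subset_closure ⟨i, rfl⟩

/-- The translation parts of the rational algebra span `ℝⁿ`. -/
theorem eq_zero_of_forall_mem_span (hp : IsAffineUniversalCover n p) [CompactSpace M]
    (hγ : Subgroup.closure (Set.range γ) = deckGroup n p)
    (hexp : ∀ i x, γ i x = affExp (a i) x)
    (hcomm : ∀ i j, affMul (a i) (a j) = affMul (a j) (a i))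
    (hmul : ∀ b ∈ Submodule.span ℚ (Set.range a), ∀ c ∈ Submodule.span ℚ (Set.range a),
      affMul b c ∈ Submodule.span ℚ (Set.range a))
    (l : AffModel n →L[ℝ] ℝ) (hl : ∀ b ∈ Submodule.span ℚ (Set.range a), l b.2 = 0) : l = 0 := by
  by_contra hl0
  -- Precomposition with the linear parts, nilpotent because `affEnd (a i)` restricts to `(a i).1`
  -- on `ℝⁿ × {0}`.
  let f : Fin n → Module.End ℝ (AffModel n →L[ℝ] ℝ) := fun i =>
    ((ContinuousLinearMap.compL ℝ (AffModel n) (AffModel n) ℝ).flip (a i).1).toLinearMap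
  have hf : ∀ i (l : AffModel n →L[ℝ] ℝ) x, f i l x = l ((a i).1 x) := fun _ _ _ => rfl
  have ha : ∀ i, a i ∈ Submodule.span ℚ (Set.range a) := fun i => Submodule.subset_span ⟨i, rfl⟩
  have hfcomm : ∀ i j, Commute (f i) (f j) := by
    intro i j
    ext l x : 2
    have h : (a i).1 ((a j).1 x) = (a j).1 ((a i).1 x) := by
      have := congrArg (fun b : AffAlg n => b.1 x) (hcomm i j)
      simpa [affMul, mul_apply_eq_comp] using this
    change l ((a j).1 ((a i).1 x)) = l ((a i).1 ((a j).1 x))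
    rw [h]
  have hfnil : ∀ i, IsNilpotent (f i) := by
    intro i
    obtain ⟨N, hN⟩ := hp.isNilpotent_affEnd hγ hexp hcomm hmul (ha i)
    have hpow : ∀ k x, (affEnd (a i) ^ k) (x, 0) = (((a i).1 ^ k) x, 0) := by
      intro k
      induction k with
      | zero => intro x; simp
      | succ k ih =>
        intro x
        rw [pow_succ, mul_apply_eq_comp, affEnd_apply, zero_smul, add_zero, ih, pow_succ,
          mul_apply_eq_comp]
    have hfpow : ∀ k (l : AffModel n →L[ℝ] ℝ) x, (f i ^ k) l x = l (((a i).1 ^ k) x) := by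
      intro k
      induction k with
      | zero => intro l x; simp
      | succ k ih =>
        intro l x
        rw [pow_succ, Module.End.mul_apply, ih, hf, pow_succ', mul_apply_eq_comp]
    refine ⟨N, ?_⟩
    ext l x : 2
    have h := hpow N x
    rw [hN] at h
    have hx : ((a i).1 ^ N) x = 0 := (congrArg Prod.fst h).symm
    rw [hfpow, hx]
    simp
  -- The annihilator of the translation parts is stable, since `(a i).1 b.2` is the translation part
  -- of `affMul (a i) b`.
  obtain ⟨k, hk, hk0, hki⟩ := exists_ne_zero_forall_apply_eq_zero f hfcomm hfnil
    {l | ∀ b ∈ Submodule.span ℚ (Set.range a), l b.2 = 0}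
    (fun i l hl b hb => hl _ (hmul _ (ha i) _ hb)) ⟨l, hl, hl0⟩ Finset.univ
  refine hk0 (hp.eq_zero_of_forall_mem_deckGroup k fun g hg => ?_)
  rw [← hγ] at hg
  induction hg using Subgroup.closure_induction with
  | mem g hg =>
    obtain ⟨i, rfl⟩ := hg
    intro x
    rw [hexp]
    refine apply_affExp_of_forall_apply_eq_zero (fun x => ?_) (hk _ (ha i)) x
    rw [← hf, hki i (Finset.mem_univ i)]
    rfl
  | one => exact fun x => rfl
  | mul g h _ _ ihg ihh => exact fun x => (ihg (h x)).trans (ihh x)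
  | inv g _ ihg =>
    intro x
    have h := ihg (g⁻¹ x)
    rw [show g (g⁻¹ x) = x from g.apply_symm_apply x] at h
    exact h.symm

/-- The deck group contains a nontrivial translation, whose direction is fixed by the linear parts
of all deck transformations. -/
theorem exists_translation (hp : IsAffineUniversalCover n p) [CompactSpace M] (hn : 0 < n)
    (hγ : Subgroup.closure (Set.range γ) = deckGroup n p)
    (hexp : ∀ i x, γ i x = affExp (a i) x)
    (hcomm : ∀ i j, affMul (a i) (a j) = affMul (a j) (a i))
    (hmul : ∀ b ∈ Submodule.span ℚ (Set.range a), ∀ c ∈ Submodule.span ℚ (Set.range a),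
      affMul b c ∈ Submodule.span ℚ (Set.range a)) :
    ∃ c : AffModel n, c ≠ 0 ∧ (∀ x, p (x + c) = p x) ∧
      ∀ g ∈ deckGroup n p, ∀ x, ∀ t : ℝ, g (x + t • c) = g x + t • c := by
  have hspan := hp.eq_zero_of_forall_mem_span hγ hexp hcomm hmul
  have ha : ∀ i, a i ∈ Submodule.span ℚ (Set.range a) := fun i => Submodule.subset_span ⟨i, rfl⟩
  -- For a zero algebra, `hspan` would make a coordinate functional vanish; this uses `0 < n`.
  obtain ⟨b, hb, hb0⟩ : ∃ b ∈ Submodule.span ℚ (Set.range a), b ≠ 0 := by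
    by_contra! h
    have hl := hspan (EuclideanSpace.proj (⟨0, hn⟩ : Fin n)) fun b hb => by rw [h b hb]; simp
    have h1 := congrArg (fun l => l (EuclideanSpace.single (⟨0, hn⟩ : Fin n) (1 : ℝ))) hl
    simp at h1
  have hP : ∀ i, ∀ y ∈ affEndRat n '' Submodule.span ℚ (Set.range a),
      affEnd (a i) * y ∈ affEndRat n '' Submodule.span ℚ (Set.range a) := by
    rintro i _ ⟨b, hb, rfl⟩
    exact ⟨affMul (a i) b, hmul _ (ha i) _ hb, affEnd_affMul _ _⟩
  obtain ⟨_, ⟨z, hz, rfl⟩, hz0, hza⟩ := exists_ne_zero_forall_mul_eq_zero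
    (fun i => affEnd (a i)) (fun i j => commute_affEnd_of_mem_span hcomm (ha i) (ha j))
    (fun i => hp.isNilpotent_affEnd hγ hexp hcomm hmul (ha i))
    (affEndRat n '' Submodule.span ℚ (Set.range a)) hP
    ⟨affEnd b, ⟨b, hb, rfl⟩, fun h => hb0 (affEnd_injective (h.trans (affEndRat n).map_zero.symm))⟩
    Finset.univ
  · have hleft : ∀ i, affMul (a i) z = 0 := fun i => by
      refine affEnd_injective ((affEnd_affMul _ _).trans ?_)
      exact (hza i (Finset.mem_univ i)).trans (affEndRat n).map_zero.symm
    have hright : ∀ b ∈ Submodule.span ℚ (Set.range a), z.1 b.2 = 0 := by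
      intro b hb
      induction hb using Submodule.span_induction with
      | mem b hb =>
        obtain ⟨i, rfl⟩ := hb
        have h : affMul z (a i) = 0 := by
          rw [← hleft i]
          refine affEnd_injective ?_
          rw [affEnd_affMul, affEnd_affMul]
          exact commute_affEnd_of_mem_span hcomm hz (ha i)
        exact congrArg Prod.snd h
      | zero => simp
      | add b c _ _ hb hc => rw [Prod.snd_add, map_add, hb, hc, add_zero]
      | smul q b _ hb => rw [Prod.smul_snd, map_rat_smul z.1, hb, smul_zero]
    have hz1 : z.1 = 0 := by
      ext x i
      have h := hspan ((EuclideanSpace.proj i).comp z.1) fun b hb => by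
        simp [hright b hb]
      exact congrArg (fun l => l x) h
    have hz2 : z.2 ≠ 0 := fun h => hz0 (by
      rw [show z = 0 from Prod.ext hz1 h, map_zero])
    obtain ⟨m, hm, hmz⟩ := exists_nsmul_mem_closure_of_mem_span_rat hz
    have hγmem : ∀ i, γ i ∈ deckGroup n p := fun i => by
      rw [← hγ]
      exact Subgroup.subset_closure ⟨i, rfl⟩
    obtain ⟨g, hg, hgz⟩ := exists_mem_eq_affExp hcomm (fun i => ⟨γ i, hγmem i, hexp i⟩) hmz
    refine ⟨m • z.2, ?_, fun x => ?_, fun g hg => ?_⟩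
    · rw [← Nat.cast_smul_eq_nsmul ℝ]
      exact smul_ne_zero (Nat.cast_ne_zero.2 hm.ne') hz2
    · have h := hg x
      rwa [hgz, affExp_of_fst_eq_zero (by simp [hz1]), Prod.smul_snd] at h
    · rw [← hγ] at hg
      induction hg using Subgroup.closure_induction with
      | mem g hg =>
        obtain ⟨i, rfl⟩ := hg
        intro x t
        have h : (a i).1 z.2 = 0 := congrArg Prod.snd (hleft i)
        rw [hexp, hexp, affExp_add_of_apply_eq_zero]
        rw [map_smul, map_nsmul, h, smul_zero, smul_zero]
      | one => exact fun x t => rfl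
      | mul g h _ _ ihg ihh =>
        intro x t
        change g (h (x + _)) = g (h x) + _
        rw [ihh, ihg]
      | inv g _ ihg =>
        intro x t
        refine g.injective ?_
        rw [ihg, show ∀ y, g (g⁻¹ y) = y from g.apply_symm_apply,
          show ∀ y, g (g⁻¹ y) = y from g.apply_symm_apply]

end IsAffineUniversalCover

end Translation

/-! ### The circle action and its smoothness -/

section CircleAction

theorem AffineMap.contDiff_of_finiteDimensional {V W : Type*} [NormedAddCommGroup V]
    [NormedSpace ℝ V] [FiniteDimensional ℝ V] [NormedAddCommGroup W] [NormedSpace ℝ W]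
    {k : ℕ∞ω} (A : V →ᵃ[ℝ] W) : ContDiff ℝ k A := by
  rw [A.decomp]
  exact (LinearMap.toContinuousLinearMap A.linear).contDiff.add contDiff_const

theorem affineGroupoid_le_contDiffGroupoid (n : ℕ) :
    affineGroupoid n ≤ contDiffGroupoid ∞ 𝓘(ℝ, AffModel n) := by
  refine groupoid_of_pregroupoid_le _ _ fun f s hf => ?_
  change ContDiffOn ℝ ∞ _ _
  intro x hx
  have hxs : x ∈ s := by simpa using hx
  obtain ⟨u, hu, hxu, A, hA⟩ := hf x hxs
  refine A.contDiff_of_finiteDimensional.contDiffWithinAt.congr_of_eventuallyEq ?_ (hA x ⟨hxs, hxu⟩)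
  filter_upwards [self_mem_nhdsWithin, mem_nhdsWithin_of_mem_nhds (hu.mem_nhds hxu)] with y hy hyu
  exact hA y ⟨by simpa using hy, hyu⟩

/-- Dividing by `z₀` moves the base point to 1, away from the branch cut of the logarithm; this
gives smooth local angles around every point. -/
theorem contMDiffAt_arg_div_self (z₀ : Circle) :
    ContMDiffAt (𝓡 1) 𝓘(ℝ, ℝ) ∞ (fun z : Circle => Complex.arg (z / z₀ : Circle)) z₀ := by
  have h1 : ContDiffAt ℝ ∞ (fun w : ℂ => (Complex.log (w / z₀)).im) z₀ := by
    refine Complex.imCLM.contDiff.contDiffAt.comp _ (ContDiffAt.comp (z₀ : ℂ) (g := Complex.log)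
      (f := fun w : ℂ => w / z₀) ?_ (contDiff_id.div_const _).contDiffAt)
    refine ContDiffAt.restrict_scalars ℝ (Complex.contDiffAt_log ?_)
    rw [div_self z₀.coe_ne_zero]
    exact Complex.one_mem_slitPlane
  have := finrank_real_complex_fact'
  have h2 : ContMDiff (𝓡 1) 𝓘(ℝ, ℂ) ∞ (fun z : Circle => (z : ℂ)) :=
    contMDiff_coe_sphere (E := ℂ) (n := 1)
  convert! h1.contMDiffAt.comp z₀ (h2 z₀) using 2 with z
  simp only [Complex.log_im]
  rfl

variable {n : ℕ} {M : Type*} [TopologicalSpace M] [ChartedSpace (AffModel n) M]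
  {p : AffModel n → M} {v : AffModel n}

namespace IsAffineUniversalCover

/-- A direction in which some translation is a deck transformation has a primitive such
translation. -/
theorem exists_primitive_translation (hp : IsAffineUniversalCover n p) {c : AffModel n}
    (hc0 : c ≠ 0) (hc : ∀ x, p (x + c) = p x) :
    ∃ b : ℝ, ∀ t : ℝ, (∀ x, p (x + t • b • c) = p x) ↔ ∃ k : ℤ, t = k := by
  let H : AddSubgroup ℝ :=
    { carrier := {t | ∀ x, p (x + t • c) = p x}
      zero_mem' := fun x => by simp
      add_mem' := fun {s t} hs ht x => by
        rw [add_smul, ← add_assoc, ht, hs]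
      neg_mem' := fun {t} ht x => by
        have h := ht (x + (-t) • c)
        rw [add_assoc, ← add_smul, neg_add_cancel, zero_smul, add_zero] at h
        exact h.symm }
  have hH : ∀ t, t ∈ H ↔ ∀ x, p (x + t • c) = p x := fun t => Iff.rfl
  have h1 : (1 : ℝ) ∈ H := fun x => by rw [one_smul, hc]
  -- Local injectivity of `p` at the origin excludes small positive periods.
  obtain ⟨ε, hε, hdisj⟩ : ∃ ε : ℝ, 0 < ε ∧ Disjoint (H : Set ℝ) (Set.Ioo 0 ε) := by
    obtain ⟨e, h0e, he⟩ := hp.isCoveringMap.isLocalHomeomorph (0 : AffModel n)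
    have hnhds : ∀ᶠ t : ℝ in 𝓝 0, t • c ∈ e.source := by
      have hcont : Continuous fun t : ℝ => t • c := by fun_prop
      refine hcont.continuousAt.eventually (e.open_source.mem_nhds ?_)
      simpa using h0e
    obtain ⟨ε, hε, hball⟩ := Metric.eventually_nhds_iff.1 hnhds
    refine ⟨ε, hε, Set.disjoint_left.2 fun t ht htε => ?_⟩
    have h2 := (hH t).1 ht 0
    rw [zero_add, he] at h2
    have h3 : t • c = 0 := e.injOn (hball (by simpa [abs_of_pos htε.1] using htε.2)) h0e h2
    exact htε.1.ne' ((smul_eq_zero.1 h3).resolve_right hc0)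
  obtain ⟨b, hb⟩ := AddSubgroup.cyclic_of_isolated_zero hε hdisj
  have hb0 : b ≠ 0 := by
    rintro rfl
    rw [hb, AddSubgroup.mem_closure_singleton] at h1
    simp at h1
  refine ⟨b, fun t => ?_⟩
  simp_rw [smul_smul]
  rw [← hH, hb, AddSubgroup.mem_closure_singleton]
  refine exists_congr fun k => ?_
  rw [zsmul_eq_mul, mul_left_inj' hb0]
  exact eq_comm

/-- A translation which is a deck transformation, and whose direction is fixed by the linear parts
of the deck transformations, defines a circle action. -/
theorem exists_circleAction (hp : IsAffineUniversalCover n p)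
    (hv : ∀ k : ℤ, ∀ x, p (x + (k : ℝ) • v) = p x)
    (hcomm : ∀ g ∈ deckGroup n p, ∀ x, ∀ t : ℝ, g (x + t • v) = g x + t • v) :
    ∃ ρ : Circle →* Equiv.Perm M, ∀ (s : ℝ) (x : AffModel n),
      ρ (Circle.exp s) (p x) = p (x + (s / (2 * Real.pi)) • v) := by
  let φ : ℝ → M → M := fun t m => p (Function.surjInv hp.surjective m + t • v)
  -- The chosen lift does not matter: two lifts differ by a deck transformation, which commutes with
  -- the flow.
  have hφ : ∀ t x, φ t (p x) = p (x + t • v) := by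
    intro t x
    obtain ⟨g, hg, hgx⟩ := hp.exists_mem_deckGroup (Function.surjInv_eq hp.surjective (p x)).symm
    change p (_ + _) = _
    rw [← hgx, ← hcomm g hg]
    exact hg _
  have hadd : ∀ s t m, φ s (φ t m) = φ (s + t) m := by
    intro s t m
    obtain ⟨x, rfl⟩ := hp.surjective m
    rw [hφ t x, hφ s (x + t • v), hφ (s + t) x, add_assoc, ← add_smul, add_comm t s]
  have hzero : ∀ m, φ 0 m = m := by
    intro m
    obtain ⟨x, rfl⟩ := hp.surjective m
    rw [hφ, zero_smul, add_zero]
  have hexp : ∀ s s' : ℝ, Circle.exp s = Circle.exp s' →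
      φ (s / (2 * Real.pi)) = φ (s' / (2 * Real.pi)) := by
    intro s s' h
    obtain ⟨k, rfl⟩ := Circle.exp_eq_exp.1 h
    ext m
    obtain ⟨x, rfl⟩ := hp.surjective m
    rw [hφ, hφ, add_div, mul_div_cancel_right₀ _ Real.two_pi_pos.ne', add_smul, ← add_assoc, hv]
  let ψ : Circle → Equiv.Perm M := fun z =>
    { toFun := φ (Complex.arg z / (2 * Real.pi))
      invFun := φ (-(Complex.arg z / (2 * Real.pi)))
      left_inv := fun m => by rw [hadd, neg_add_cancel, hzero]
      right_inv := fun m => by rw [hadd, add_neg_cancel, hzero] }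
  have hψ : ∀ s m, ψ (Circle.exp s) m = φ (s / (2 * Real.pi)) m := fun s m =>
    congrFun (hexp _ _ (Circle.exp_arg _)) m
  refine ⟨MonoidHom.mk' ψ fun z w => ?_, fun s x => (hψ s (p x)).trans (hφ _ x)⟩
  obtain ⟨s, rfl⟩ := Circle.exp_surjective z
  obtain ⟨t, rfl⟩ := Circle.exp_surjective w
  ext m
  rw [← Circle.exp_add, hψ, Equiv.Perm.mul_apply, hψ, hψ, hadd, add_div]

theorem contMDiff (hp : IsAffineUniversalCover n p) :
    ContMDiff 𝓘(ℝ, AffModel n) 𝓘(ℝ, AffModel n) ∞ p := by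
  intro x
  obtain ⟨A, hA⟩ := hp.locally_affine x
  refine contMDiffAt_iff_target.2 ⟨hp.isCoveringMap.continuous.continuousAt, ?_⟩
  refine (A.contDiff_of_finiteDimensional.contDiffAt.contMDiffAt).congr_of_eventuallyEq ?_
  filter_upwards [hA] with y hy
  simpa using hy

variable [HasGroupoid M (affineGroupoid n)]

/-- An affine universal covering has smooth local sections. -/
theorem exists_contMDiffAt_section (hp : IsAffineUniversalCover n p) (x : AffModel n) :
    ∃ σ : M → AffModel n, ContMDiffAt 𝓘(ℝ, AffModel n) 𝓘(ℝ, AffModel n) ∞ σ (p x) ∧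
      σ (p x) = x ∧ ∀ᶠ y in 𝓝 (p x), p (σ y) = y := by
  have hle := affineGroupoid_le_contDiffGroupoid n
  have : HasGroupoid M (contDiffGroupoid ∞ 𝓘(ℝ, AffModel n)) := hasGroupoid_of_le ‹_› hle
  have : IsManifold 𝓘(ℝ, AffModel n) ∞ M := ⟨⟩
  obtain ⟨A, hA⟩ := hp.exists_affineEquiv x
  refine ⟨A.symm ∘ extChartAt 𝓘(ℝ, AffModel n) (p x), ?_, ?_, ?_⟩
  · exact ((A.symm : AffModel n →ᵃ[ℝ] AffModel n).contDiff_of_finiteDimensional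
      |>.contMDiff.contMDiffAt).comp _ contMDiffAt_extChartAt
  · simp [hA.self_of_nhds]
  · rw [← hp.isCoveringMap.isLocalHomeomorph.map_nhds_eq, Filter.eventually_map]
    filter_upwards [hA] with y hy
    simp [hy]

theorem isParallelCircleAction (hp : IsAffineUniversalCover n p) (ρ : Circle →* Equiv.Perm M)
    (hρ : ∀ (s : ℝ) (x : AffModel n),
      ρ (Circle.exp s) (p x) = p (x + (s / (2 * Real.pi)) • v)) :
    IsParallelCircleAction n ρ where
  smooth := by
    rintro ⟨z₀, m₀⟩
    obtain ⟨x₀, rfl⟩ := hp.surjective m₀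
    obtain ⟨s₀, rfl⟩ := Circle.exp_surjective z₀
    obtain ⟨σ, hσ, hσx, hpσ⟩ := hp.exists_contMDiffAt_section x₀
    -- A lift of the angle, in full turns, smooth near `Circle.exp s₀`; there the action reads `p (σ
    -- y + τ z • v)`.
    let τ : Circle → ℝ := fun z =>
      (s₀ + Complex.arg (z / Circle.exp s₀ : Circle)) / (2 * Real.pi)
    have hτ : ContMDiffAt (𝓡 1) 𝓘(ℝ, ℝ) ∞ τ (Circle.exp s₀) := by
      have h : ContDiff ℝ ∞ fun t : ℝ => (s₀ + t) / (2 * Real.pi) :=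
        (contDiff_const.add contDiff_id).div_const _
      exact (h.contMDiff.contMDiffAt).comp _ (contMDiffAt_arg_div_self _)
    have hsm : ContMDiffAt ((𝓡 1).prod 𝓘(ℝ, AffModel n)) 𝓘(ℝ, AffModel n) ∞
        (fun q : Circle × M => p (σ q.2 + τ q.1 • v)) (Circle.exp s₀, p x₀) := by
      refine (hp.contMDiff _).comp _ (ContMDiffAt.add ?_ ?_)
      · exact hσ.comp (Circle.exp s₀, p x₀) contMDiffAt_snd
      · have h : ContDiff ℝ ∞ fun t : ℝ => t • v := contDiff_id.smul contDiff_const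
        exact h.contMDiff.contMDiffAt.comp _ (hτ.comp (Circle.exp s₀, p x₀) contMDiffAt_fst)
    refine hsm.congr_of_eventuallyEq ?_
    filter_upwards [continuousAt_snd.eventually hpσ] with q hq
    have hq1 : Circle.exp (s₀ + Complex.arg (q.1 / Circle.exp s₀ : Circle)) = q.1 := by
      rw [Circle.exp_add, Circle.exp_arg, mul_div_cancel]
    have h := hρ (s₀ + Complex.arg (q.1 / Circle.exp s₀ : Circle)) (σ q.2)
    rw [hq1, hq] at h
    exact h
  parallel := by
    intro m
    obtain ⟨x, rfl⟩ := hp.surjective m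
    obtain ⟨A, hA⟩ := hp.locally_affine x
    refine ⟨A.linear ((1 / (2 * Real.pi)) • v), ?_⟩
    rw [← hp.isCoveringMap.isLocalHomeomorph.map_nhds_eq, Filter.eventually_map]
    -- The affine formula is needed on a neighbourhood of each `y`, as the orbit leaves `y`. Its
    -- derivative involves only `A.linear`, so it does not depend on `y`.
    filter_upwards [hA.eventually_nhds] with y hy
    have hline : HasDerivAt (fun t : ℝ => y + (t / (2 * Real.pi)) • v)
        ((1 / (2 * Real.pi)) • v) 0 :=
      (((hasDerivAt_id (0 : ℝ)).div_const _).smul_const v).const_add y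
    have hline0 : y + ((0 : ℝ) / (2 * Real.pi)) • v = y := by simp
    have hderiv := (A.hasFDerivAt_of_finiteDimensional
      (y + ((0 : ℝ) / (2 * Real.pi)) • v)).comp_hasDerivAt (0 : ℝ) hline
    refine hderiv.congr_of_eventuallyEq ?_
    rw [← hline0] at hy
    filter_upwards [hline.continuousAt.eventually hy] with t ht
    rw [hρ, ht]
    rfl

end IsAffineUniversalCover

end CircleAction

end

theorem proposition4p1 (n : ℕ) (hn : 0 < n) (M : Type*) [TopologicalSpace M]
    [ChartedSpace (AffModel n) M] [HasGroupoid M (affineGroupoid n)]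
    (htorus : Nonempty (M ≃ₘ⟮𝓘(ℝ, AffModel n), torusModel n⟯ Torus n))
    (hcomplete : IsGeodesicallyComplete n M)
    (hrational : HasRationalAlgebra n M) :
    ∃ ρ : Circle →* Equiv.Perm M,
      Function.Injective ρ ∧ IsParallelCircleAction n ρ := by
  obtain ⟨e⟩ := htorus
  have : CompactSpace M := e.toHomeomorph.symm.compactSpace
  obtain ⟨p, hp, γ, a, hγ, hexp, hcomm, hmul⟩ := hrational
  obtain ⟨c, hc0, hc, hcg⟩ := hp.exists_translation hn hγ hexp hcomm hmul
  obtain ⟨b, hb⟩ := hp.exists_primitive_translation hc0 hc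
  obtain ⟨ρ, hρ⟩ := hp.exists_circleAction (v := b • c) (fun k => (hb k).2 ⟨k, rfl⟩)
    (fun g hg x t => by rw [smul_smul, hcg g hg])
  refine ⟨ρ, (injective_iff_map_eq_one ρ).2 fun z hz => ?_, hp.isParallelCircleAction ρ hρ⟩
  obtain ⟨s, rfl⟩ := Circle.exp_surjective z
  -- A trivially acting `Circle.exp s` makes `s / (2 * π)` a period, hence an integer by
  -- primitivity.
  obtain ⟨k, hk⟩ := (hb (s / (2 * Real.pi))).1 fun x => by
    rw [← hρ, hz]
    rfl
  exact Circle.exp_eq_one.2 ⟨k, (div_eq_iff Real.two_pi_pos.ne').1 hk⟩
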